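/- Let $X\subseteq\mathbb{N}^2$. For an integer $n\ge 0$ write $[n]=\{1,\dots,n\}$ and let $\mathfrak{S}_n$ be the group of permutations of $[n]$. For $\pi=\pi_1\cdots\pi_n\in\mathfrak{S}_n$ put $\mathrm{XDes}(\pi)=\{i : 1\le i\le n-1,\ (\pi_i,\pi_{i+1})\in X\}$, and let $d_X(\emptyset;n)$ be the number of $\pi\in\mathfrak{S}_n$ with $\mathrm{XDes}(\pi)=\emptyset$. Let $G_n(X)$ be the directed graph with vertex set $[n]$ in which $i\to j$ is an edge if and only if $i\ne j$ and $(i,j)\notin X$, and let $\overline{G_n(X)}$ be its complement, in which $i\to j$ is an edge if and only if $i\neq j$ and $i\to j$ is not an edge of $G_n(X)$. For $w\in\mathfrak{S}_n$, let $\mathrm{nsc}(w)$ be the number of nontrivial cycles (cycles of length at least $2$) in the disjoint cycle decomposition of $w$. Suppose that for each $n$ the directed graph $G_n(X)$ is a tournament, that is, for any two distinct vertices $i,j\in[n]$ exactly one of $i\to j$ and $j\to i$ is an edge (so that $\overline{G_n(X)}$ is $G_n(X)$ with all edges reversed). Then for every $n$ $$d_X(\emptyset;n)=\sum_{w}2^{\mathrm{nsc}(w)},$$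 where the sum ranges over all $w\in\mathfrak{S}_n$ of odd order such that every nontrivial cycle $(v_1\,v_2\,\cdots\,v_k)$ of $w$ (meaning $w(v_1)=v_2,\dots,w(v_k)=v_1$) is a directed cycle $v_1\to v_2\to\cdots\to v_k\to v_1$ of $\overline{G_n(X)}$. -/

import Mathlib

namespace XDescent

/-- The set `[n] = {1, …, n}` as a type. -/
abbrev Bracket (n : ℕ) : Type := ↥(Finset.Icc 1 n)

/-- The `X`-descent set `{i ∈ [n-1] : (π_i, π_{i+1}) ∈ X}` of a permutation `π` of `[n]`.
Requiring `i` and `i + 1` to lie in `[n]` says exactly that `1 ≤ i ≤ n - 1`. -/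
def XDes (X : Set (ℕ × ℕ)) {n : ℕ} (π : Equiv.Perm (Bracket n)) : Set ℕ :=
  {i | ∃ (hi : i ∈ Finset.Icc 1 n) (hi' : i + 1 ∈ Finset.Icc 1 n),
    ((π ⟨i, hi⟩ : ℕ), (π ⟨i + 1, hi'⟩ : ℕ)) ∈ X}

/-- `𝒟_X(I; n)`: the permutations of `[n]` whose `X`-descent set is exactly `I`. -/
def descentClass (X : Set (ℕ × ℕ)) (I : Set ℕ) (n : ℕ) : Set (Equiv.Perm (Bracket n)) :=
  {π | XDes X π = I}

/-- `d_X(I; n) = |𝒟_X(I; n)|`. -/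
noncomputable def descentCount (X : Set (ℕ × ℕ)) (I : Set ℕ) (n : ℕ) : ℕ :=
  (descentClass X I n).ncard

/-- The directed graph `G_n(X)` on `[n]`: there is an edge `i → j` iff `(i, j) ∉ X` and `i ≠ j`. -/
def descentGraph (X : Set (ℕ × ℕ)) (n : ℕ) : Digraph (Bracket n) where
  Adj i j := ((i : ℕ), (j : ℕ)) ∉ X ∧ i ≠ j

/-- A tournament: no loops, and between two distinct vertices exactly one of the two possible
edges is present. -/
def IsTournament {V : Type*} (D : Digraph V) : Prop :=
  (∀ v, ¬ D.Adj v v) ∧ ∀ u v, u ≠ v → Xor (D.Adj u v) (D.Adj v u)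

/-- The (loopless) complement of a directed graph: `u → v` is an edge iff `u ≠ v` and `u → v` is
not an edge of `D`. -/
def complement {V : Type*} (D : Digraph V) : Digraph V where
  Adj u v := u ≠ v ∧ ¬ D.Adj u v

/-- The complement of a tournament is obtained by reversing all edges. -/
theorem complement_adj_iff_of_isTournament {V : Type*} {D : Digraph V} (hD : IsTournament D)
    (u v : V) : (complement D).Adj u v ↔ D.Adj v u := by
  by_cases h : u = v
  · subst h
    simp [complement, hD.1 u]
  · have := hD.2 u v h
    simp only [complement, Xor] at *
    tauto

/-- `c` is a cyclic permutation `(v₁ v₂ … v_k)`, `k ≥ 2`, and `v₁ → v₂ → ⋯ → v_k → v₁` is a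
directed cycle of `D`. -/
def IsDirectedCycleOf {V : Type*} (D : Digraph V) (c : Equiv.Perm V) : Prop :=
  c.IsCycle ∧ ∀ v, c v ≠ v → D.Adj v (c v)

/-- `nsc(w)`: the number of nontrivial cycles in the disjoint cycle decomposition of `w`. -/
def nsc {V : Type*} [Fintype V] [DecidableEq V] (w : Equiv.Perm V) : ℕ :=
  w.cycleFactorsFinset.card

open Classical in
/-- The permutations of odd order each of whose nontrivial cycles is a directed cycle of `D`. -/
noncomputable def oddCyclePerms {V : Type*} [Fintype V] [DecidableEq V] (D : Digraph V) :
    Finset (Equiv.Perm V) :=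
  {w | Odd (orderOf w) ∧ ∀ c ∈ w.cycleFactorsFinset, IsDirectedCycleOf D c}

end XDescent

/-!
A permutation `π` without `X`-descents is a Hamiltonian path of `D = descentGraph X n`. Adding a
point `none` turns listings of `V = [n]` into full cycles `τ` of `Option V`. Let `B` be the
adjacency matrix of `complement D`, extended by `0` to arcs at `none`. The number of Hamiltonian
paths of `D` is then `∑ τ, ∏ v, (1 - B v (τ v))`, which is expanded over the sets `T` of points `v`
where the term `-B v (τ v)` is chosen.

For fixed `T`, the arcs of `τ` leaving `T` form `m = #Tᶜ` disjoint paths in `V` (complement in `V`),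
or their weight is `0` because one of them ends in `none`. A given family of such paths extends to
`m!` full cycles of `Option V` (`card_isFullCycle_eqOn`: arrange the paths and `none` in a circle)
and to `m!` permutations of `V` (`card_eqOn`). So full cycles can be traded for arbitrary
permutations `σ` of `V`, at the price of admitting only sets `T` that contain no cycle of `σ`
(`sum_isFullCycle_prod`). For fixed `σ` the sum over these `T` factors over the nontrivial cycles
`c` of `σ` (`sum_noCycleIn_prod`) with factors
`∏ v ∈ c.support, (1 - B v (c v)) - ∏ v ∈ c.support, -B v (c v)`.

Since `D` is a tournament, `1 - B v w = B w v` for `v ≠ w`, so the first product is the weight of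
the reversed cycle `c⁻¹`. In the sum over all `σ` cycles can be reversed independently
(`sum_prod_cycleFactors_inv_add`), so the factor of `c` may be replaced by
`(1 - (-1) ^ #c.support) * ∏ v ∈ c.support, B v (c v)`. It is `2` if `c` is a directed cycle of
`complement D` of odd length, and `0` otherwise; and all cycles of `σ` have odd length exactly when
`σ` has odd order.
-/

namespace XDescent

open Equiv Finset

/-- `τ` consists of a single cycle through all of `V`: every two points lie on a common cycle.
Unlike `Equiv.Perm.IsCycle`, this admits the identity of a one-point type. -/
def IsFullCycle {V : Type*} (τ : Perm V) : Prop := ∀ a b, τ.SameCycle a b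

/-- No cycle of `σ` lies inside `T`: every cycle, fixed points included, meets the complement
of `T`. Equivalently, the arcs `v → σ v` with `v ∈ T` form a disjoint union of paths. -/
def NoCycleIn {V : Type*} (σ : Perm V) (T : Finset V) : Prop := ∀ v, ∃ w ∉ T, σ.SameCycle v w

/-! ### Completing a family of paths to a full cycle or to a permutation -/

section Counting

variable {V : Type*}

theorem sameCycle_of_eqOn_cycle [Finite V] {σ σ' : Perm V} {v w : V}
    (h : ∀ w, σ'.SameCycle v w → σ w = σ' w) (hw : σ.SameCycle v w) : σ'.SameCycle v w := by
  obtain ⟨k, rfl⟩ := hw.exists_nat_pow_eq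
  clear hw
  induction k with
  | zero => exact Perm.SameCycle.rfl
  | succ k ih =>
    rw [pow_succ', Perm.mul_apply, h _ ih]
    exact Perm.sameCycle_apply_right.2 ih

/-- `NoCycleIn σ T` depends only on the restriction of `σ` to `T`. -/
theorem NoCycleIn.congr [Finite V] {σ σ' : Perm V} {T : Finset V} (hσ : NoCycleIn σ T)
    (h : ∀ v ∈ T, σ' v = σ v) : NoCycleIn σ' T := by
  intro v
  by_contra! hv
  obtain ⟨w, hwT, hw⟩ := hσ v
  exact hv w hwT (sameCycle_of_eqOn_cycle
    (fun w hw => (h w (by_contra fun hwT => hv w hwT hw)).symm) hw)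

theorem NoCycleIn.exists_first_exit [Finite V] {σ : Perm V} {T : Finset V}
    (hσ : NoCycleIn σ T) (v : V) :
    ∃ k : ℕ, (σ ^ k) v ∉ T ∧ ∀ j < k, (σ ^ j) v ∈ T := by
  classical
  have hex : ∃ k : ℕ, (σ ^ k) v ∉ T := by
    obtain ⟨w, hwT, hw⟩ := hσ v
    obtain ⟨k, rfl⟩ := hw.exists_nat_pow_eq
    exact ⟨k, hwT⟩
  exact ⟨Nat.find hex, Nat.find_spec hex, fun j hj => not_not.1 (Nat.find_min hex hj)⟩

/-- A permutation is determined by its values at all points but one. -/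
theorem eq_of_eqOn_of_forall_notMem_eq {σ τ : Perm V} {T : Finset V} {u : V}
    (hT : ∀ v, v ∉ T → v = u) (h : ∀ v ∈ T, τ v = σ v) : τ = σ := by
  have key : σ⁻¹ * τ = 1 := by
    have hfix : ∀ v ∈ T, (σ⁻¹ * τ) v = v := fun v hv => by simp [h v hv]
    ext v
    by_cases hv : v ∈ T
    · exact hfix v hv
    · by_cases hw : (σ⁻¹ * τ) v ∈ T
      · exact absurd ((σ⁻¹ * τ).injective (hfix _ hw) ▸ hw) hv
      · simpa [hT v hv] using hT _ hw
  exact (inv_mul_eq_one.1 key).symm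

/-- If the path from `σ y` through `T` ends at `u`, then adding the arc `u → σ y` closes it to a
cycle, which is not everything as long as it misses some `z`. -/
theorem not_isFullCycle_of_return [Finite V] {σ τ : Perm V} {T : Finset V} {u y z : V} {k : ℕ}
    (hk : ∀ j < k, (σ ^ j) (σ y) ∈ T) (hu : (σ ^ k) (σ y) = u) (hz : z ∉ T) (hzu : z ≠ u)
    (hτT : ∀ v ∈ T, τ v = σ v) (hτu : τ u = σ y) : ¬ IsFullCycle τ := by
  intro hτ
  obtain ⟨i, hi⟩ := (hτ u z).exists_nat_pow_eq
  have orbit : ∀ i : ℕ, ∃ j ≤ k, (τ ^ i) u = (σ ^ j) (σ y) := by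
    intro i
    induction i with
    | zero => exact ⟨k, le_rfl, hu.symm⟩
    | succ i ih =>
      obtain ⟨j, hj, hij⟩ := ih
      rw [pow_succ', Perm.mul_apply, hij]
      rcases hj.lt_or_eq with hj | rfl
      · exact ⟨j + 1, hj, by rw [hτT _ (hk j hj), pow_succ' σ, Perm.mul_apply]⟩
      · exact ⟨0, Nat.zero_le _, by rw [hu, hτu]; rfl⟩
  obtain ⟨j, hj, hij⟩ := orbit i
  rw [hi] at hij
  rcases hj.lt_or_eq with hj | rfl
  · exact hz (hij ▸ hk j hj)
  · exact hzu (hij.trans hu)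

/-- Let the path from `σ y₀` through `T` end at `u`. The permutation `σ * swap u y` adds the arc
`u → σ y` to the arcs of `σ` leaving `T`. If `y ≠ y₀`, this arc leads into another path, so that
no cycle arises inside `insert u T`. -/
theorem NoCycleIn.mul_swap [Finite V] [DecidableEq V] {σ : Perm V} {T : Finset V}
    {u y₀ y : V} {k : ℕ} (hσ : NoCycleIn σ T) (hk : ∀ j < k, (σ ^ j) (σ y₀) ∈ T)
    (hu : (σ ^ k) (σ y₀) = u) (huT : u ∉ T) (hy₀ : y₀ ∉ T) (hy : y ∉ T) (hne : y ≠ y₀) :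
    NoCycleIn (σ * swap u y) (insert u T) := by
  set σ' := σ * swap u y with hσ'
  have eqT : ∀ v ∈ T, σ' v = σ v := fun v hv => by
    rw [hσ', Perm.mul_apply, swap_apply_of_ne_of_ne] <;> rintro rfl <;> contradiction
  intro v
  by_contra! hv
  have hin : ∀ w, σ'.SameCycle v w → w ∈ insert u T := fun w hw =>
    by_contra fun h => hv w h hw
  have hvu : σ'.SameCycle v u := by
    by_contra hvu
    obtain ⟨w, hwT, hw⟩ := hσ v
    have hinT : ∀ w, σ'.SameCycle v w → w ∈ T := fun w hw =>
      (mem_insert.1 (hin w hw)).resolve_left fun h => hvu (h ▸ hw)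
    exact hwT (hinT w (sameCycle_of_eqOn_cycle (fun w hw => (eqT w (hinT w hw)).symm) hw))
  -- A cycle inside `insert u T` passes through `u`; going back from `u` it runs through the whole
  -- path and reaches `σ y₀`, whose preimage under `σ'` is not in `insert u T`.
  have back : ∀ i ≤ k, σ'.SameCycle v ((σ ^ (k - i)) (σ y₀)) := by
    intro i
    induction i with
    | zero => intro _; rwa [Nat.sub_zero, hu]
    | succ i ih =>
      intro hi
      have h1 := ih (by omega)
      have h2 : k - i = (k - (i + 1)) + 1 := by omega
      rw [h2, pow_succ', Perm.mul_apply, ← eqT _ (hk _ (by omega))] at h1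
      exact Perm.sameCycle_apply_right.1 h1
  have h0 : σ'.SameCycle v (σ y₀) := by simpa using back k le_rfl
  have h1 : σ' (swap u y y₀) = σ y₀ := by simp [hσ']
  rw [← h1] at h0
  have h2 := hin _ (Perm.sameCycle_apply_right.1 h0)
  by_cases h : y₀ = u
  · rw [h, swap_apply_left] at h2
    exact hne ((mem_insert.1 h2).resolve_right hy |>.trans h.symm)
  · rw [swap_apply_of_ne_of_ne h hne.symm] at h2
    exact (mem_insert.1 h2).elim h hy₀

open Classical in
/-- The arcs `v → σ v` leaving `T` form `#Tᶜ` paths, and these can be arranged in a cycle in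
`(#Tᶜ - 1)!` ways. Induction on the number of paths: pick a path, ending at `u`, say; a full cycle
sends `u` to the start of one of the other paths, and so joins two paths into one. -/
theorem card_isFullCycle_eqOn [Fintype V] [DecidableEq V] (m : ℕ) :
    ∀ (T : Finset V) (σ : Perm V), #Tᶜ = m + 1 → NoCycleIn σ T →
      #{τ : Perm V | IsFullCycle τ ∧ ∀ v ∈ T, τ v = σ v} = m.factorial := by
  induction m with
  | zero =>
    intro T σ hT hσ
    obtain ⟨u, hu⟩ := card_eq_one.1 hT
    have hT' : ∀ v, v ∉ T → v = u := fun v hv => by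
      simpa [hu] using mem_compl.2 hv
    have hfull : IsFullCycle σ := by
      have : ∀ a, σ.SameCycle a u := fun a => by
        obtain ⟨w, hw, h⟩ := hσ a
        rwa [← hT' w hw]
      exact fun a b => (this a).trans (this b).symm
    rw [Nat.factorial_zero, card_eq_one]
    refine ⟨σ, ?_⟩
    ext τ
    simp only [mem_filter, mem_univ, true_and, mem_singleton]
    exact ⟨fun h => eq_of_eqOn_of_forall_notMem_eq hT' h.2,
      by rintro rfl; exact ⟨hfull, fun _ _ => rfl⟩⟩
  | succ m ih =>
    intro T σ hT hσ
    obtain ⟨y₀, hy₀⟩ : (Tᶜ).Nonempty := card_pos.1 (by omega)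
    obtain ⟨k, huT, hk⟩ := hσ.exists_first_exit (σ y₀)
    obtain ⟨u, hu⟩ : ∃ u, (σ ^ k) (σ y₀) = u := ⟨_, rfl⟩
    rw [hu] at huT
    obtain ⟨z, hz, hzu⟩ : ∃ z ∈ Tᶜ, z ≠ u := exists_mem_ne (by omega) u
    have maps : ∀ τ ∈ ({τ : Perm V | IsFullCycle τ ∧ ∀ v ∈ T, τ v = σ v} : Finset _),
        σ⁻¹ (τ u) ∈ Tᶜ := by
      intro τ hτ
      simp only [mem_filter, mem_univ, true_and] at hτ
      rw [mem_compl]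
      intro h
      have := hτ.2 _ h
      exact huT (τ.injective (this.trans (σ.apply_symm_apply (τ u))) ▸ h)
    rw [card_eq_sum_card_fiberwise maps]
    -- The value `σ y` at `u` is admissible for all `y` outside `T` except `y₀`.
    have fiber : ∀ y ∈ Tᶜ,
        #{τ ∈ ({τ : Perm V | IsFullCycle τ ∧ ∀ v ∈ T, τ v = σ v} : Finset _) | σ⁻¹ (τ u) = y}
          = if y = y₀ then 0 else m.factorial := by
      intro y hy
      split_ifs with h
      · rw [card_eq_zero, filter_eq_empty_iff]
        intro τ hτ hτu
        simp only [mem_filter, mem_univ, true_and] at hτ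
        subst h
        exact not_isFullCycle_of_return hk hu (mem_compl.1 hz) hzu hτ.2
          (Perm.inv_eq_iff_eq.1 hτu) hτ.1
      · rw [← ih (insert u T) (σ * swap u y) (by
            rw [card_compl, card_insert_of_notMem huT]; rw [card_compl] at hT; omega)
          (hσ.mul_swap hk hu huT (mem_compl.1 hy₀) (mem_compl.1 hy) h)]
        congr 1
        ext τ
        simp only [mem_filter, mem_univ, true_and, mem_insert, forall_eq_or_imp, Perm.mul_apply,
          swap_apply_left, and_assoc, Perm.inv_eq_iff_eq]
        have eqT : ∀ v ∈ T, swap u y v = v := fun v hv =>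
          swap_apply_of_ne_of_ne (by rintro rfl; contradiction)
            (by rintro rfl; exact mem_compl.1 hy hv)
        refine and_congr_right fun _ => ?_
        rw [and_comm]
        refine and_congr Iff.rfl (forall₂_congr fun v hv => by rw [eqT v hv])
    rw [sum_congr rfl fiber, ← add_sum_erase _ _ hy₀, if_pos rfl, zero_add,
      sum_congr rfl (fun y hy => if_neg (ne_of_mem_erase hy)), sum_const, card_erase_of_mem hy₀,
      hT, smul_eq_mul, Nat.factorial_succ, Nat.add_sub_cancel]

theorem card_eqOn [Fintype V] [DecidableEq V] (T : Finset V) (σ : Perm V) :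
    #{τ : Perm V | ∀ v ∈ T, τ v = σ v} = (#Tᶜ).factorial := by
  have h1 : #{τ : Perm V | ∀ v ∈ T, τ v = σ v} = #{τ : Perm V | ∀ v, ¬ v ∈ Tᶜ → τ v = v} := by
    refine card_bij' (fun τ _ => σ⁻¹ * τ) (fun τ _ => σ * τ) ?_ ?_ ?_ ?_ <;>
      simp +contextual
  rw [h1, ← Fintype.card_subtype,
    ← Fintype.card_congr (Perm.subtypeEquivSubtypePerm (fun v => v ∈ Tᶜ)), Fintype.card_perm,
    Fintype.card_coe]

end Counting

/-! ### From full cycles through an extra point to permutations -/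

section Transfer

variable {V : Type*}

theorem NoCycleIn.optionCongr [Finite V] {σ : Perm V} {T : Finset V} (hσ : NoCycleIn σ T) :
    NoCycleIn (V := Option V) (Equiv.optionCongr σ) (T.map Function.Embedding.some) := by
  intro o
  cases o with
  | none => exact ⟨none, by simp, Perm.SameCycle.rfl⟩
  | some v =>
    obtain ⟨w, hw, hvw⟩ := hσ v
    obtain ⟨k, rfl⟩ := hvw.exists_nat_pow_eq
    refine ⟨some ((σ ^ k) v), by simpa using hw, k, ?_⟩
    rw [zpow_natCast]
    clear hw hvw
    induction k with
    | zero => rfl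
    | succ k ih => rw [pow_succ', Perm.mul_apply, ih, pow_succ', Perm.mul_apply]; rfl

/-- If the arcs of a full cycle on `Option V` leaving `T` avoid `none`, they contain no cycle, and
they remain arcs when `none` is bypassed. -/
theorem IsFullCycle.noCycleIn_removeNone [Finite V] {τ : Perm (Option V)}
    (hτ : IsFullCycle τ) {T : Finset V} (hT : ∀ v ∈ T, τ (some v) ≠ none) :
    NoCycleIn (removeNone τ) T := by
  intro v
  by_contra! hv
  obtain ⟨k, hk⟩ := (hτ (some v) none).exists_nat_pow_eq
  have key : ∀ k : ℕ, (τ ^ k) (some v) = some (((removeNone τ : Perm V) ^ k) v) := by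
    intro k
    induction k with
    | zero => rfl
    | succ k ih =>
      rw [pow_succ', Perm.mul_apply, ih, pow_succ', Perm.mul_apply]
      refine (removeNone_some τ (Option.ne_none_iff_exists'.1 (hT _ ?_))).symm
      by_contra h
      exact hv _ h ⟨k, by rw [zpow_natCast]⟩
  rw [key] at hk
  cases hk

variable [Fintype V] [DecidableEq V]

open Classical in
/-- Both sides sum the products of `B` over all families of disjoint paths in `V` with arcs leaving
exactly the points of `T`, each family counted `(#Tᶜ)!` times: it has that many completions to a
full cycle on `Option V` and that many completions to a permutation of `V`. -/
theorem sum_isFullCycle_prod {R : Type*} [CommRing R] [IsDomain R] [CharZero R] (B : V → V → R)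
    (T : Finset V) :
    ∑ τ : Perm (Option V) with IsFullCycle τ, ∏ v ∈ T, (τ (some v)).elim 0 (B v) =
      ∑ σ : Perm V with NoCycleIn σ T, ∏ v ∈ T, B v (σ v) := by
  have hN : ((#Tᶜ).factorial : R) ≠ 0 := Nat.cast_ne_zero.2 (Nat.factorial_ne_zero _)
  -- Double counting of the pairs `(τ, σ)` that agree on `T`.
  refine mul_left_cancel₀ hN ?_
  have hτ : ∀ τ ∈ ({τ : Perm (Option V) | IsFullCycle τ} : Finset _),
      ∑ σ : Perm V with NoCycleIn σ T, (if ∀ v ∈ T, τ (some v) = some (σ v) then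
        ∏ v ∈ T, B v (σ v) else 0) =
      (#Tᶜ).factorial * ∏ v ∈ T, (τ (some v)).elim 0 (B v) := by
    intro τ hτ
    rw [mem_filter] at hτ
    by_cases hT : ∀ v ∈ T, τ (some v) ≠ none
    · have hr : ∀ v ∈ T, τ (some v) = some (removeNone τ v) := fun v hv =>
        (removeNone_some τ (Option.ne_none_iff_exists'.1 (hT v hv))).symm
      rw [← sum_filter, filter_filter, ← card_eqOn T (removeNone τ), ← nsmul_eq_mul, ← sum_const]
      refine sum_congr ?_ fun σ hσ => prod_congr rfl fun v hv => ?_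
      · ext σ
        simp only [mem_filter, mem_univ, true_and]
        refine ⟨fun h v hv => Option.some_injective _ (by rw [← h.2 v hv, hr v hv]), fun h =>
          ⟨(hτ.2.noCycleIn_removeNone hT).congr h, fun v hv => by rw [hr v hv, h v hv]⟩⟩
      · rw [mem_filter] at hσ
        rw [hr v hv, hσ.2 v hv]
        rfl
    · push Not at hT
      obtain ⟨v, hv, hvn⟩ := hT
      rw [prod_eq_zero hv (by rw [hvn]; rfl), mul_zero]
      refine sum_eq_zero fun σ _ => if_neg fun h => ?_
      have := h v hv
      rw [hvn] at this
      cases this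
  have hσ : ∀ σ ∈ ({σ : Perm V | NoCycleIn σ T} : Finset _),
      ∑ τ : Perm (Option V) with IsFullCycle τ, (if ∀ v ∈ T, τ (some v) = some (σ v) then
        ∏ v ∈ T, B v (σ v) else 0) = (#Tᶜ).factorial * ∏ v ∈ T, B v (σ v) := by
    intro σ hσ
    rw [mem_filter] at hσ
    have hcard : #(T.map Function.Embedding.some : Finset (Option V))ᶜ = #Tᶜ + 1 := by
      have := card_le_univ T
      rw [card_compl, card_compl, card_map, Fintype.card_option]
      omega
    rw [← sum_filter, filter_filter, sum_const, nsmul_eq_mul,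
      ← card_isFullCycle_eqOn _ _ _ hcard hσ.2.optionCongr]
    congr 3
    ext τ
    simp
  rw [mul_sum, mul_sum, ← sum_congr rfl hτ, ← sum_congr rfl hσ, sum_comm]

/-! ### Factoring over the cycles of a permutation -/

theorem prod_mul_prod_compl_one_add {R : Type*} [CommRing R] (y : V → R) (U : Finset V) :
    (∏ v ∈ U, y v) * ∏ v ∈ Uᶜ, (1 + y v) = ∑ T with U ⊆ T, ∏ v ∈ T, y v := by
  rw [prod_one_add, mul_sum]
  refine sum_bij' (fun S _ => U ∪ S) (fun T _ => T \ U) ?_ ?_ ?_ ?_ ?_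
  · intro S _; simp
  · intro T _
    rw [mem_powerset]
    exact fun v hv => mem_compl.2 (mem_sdiff.1 hv).2
  · intro S hS
    have : Disjoint U S := (subset_compl_iff_disjoint_left.1 (mem_powerset.1 hS))
    rw [union_sdiff_cancel_left this]
  · intro T hT
    exact union_sdiff_of_subset (mem_filter.1 hT).2
  · intro S hS
    have : Disjoint U S := (subset_compl_iff_disjoint_left.1 (mem_powerset.1 hS))
    rw [prod_union this]

theorem pairwiseDisjoint_support (σ : Perm V) {A : Finset (Perm V)}
    (hA : A ⊆ σ.cycleFactorsFinset) : (A : Set (Perm V)).PairwiseDisjoint Perm.support :=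
  fun _ hc _ hd hcd => Perm.disjoint_iff_disjoint_support.1
    (σ.cycleFactorsFinset_pairwise_disjoint (hA hc) (hA hd) hcd)

theorem noCycleIn_iff {σ : Perm V} {T : Finset V} (hT : ∀ v ∈ T, σ v ≠ v) :
    NoCycleIn σ T ↔ ∀ c ∈ σ.cycleFactorsFinset, ¬ c.support ⊆ T := by
  constructor
  · intro h c hc hcT
    obtain ⟨v, hv⟩ := (Perm.mem_cycleFactorsFinset_iff.1 hc).1.nonempty_support
    obtain ⟨w, hw, hvw⟩ := h v
    refine hw (hcT ?_)
    rw [Perm.cycle_is_cycleOf hv hc, Perm.mem_support_cycleOf_iff]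
    exact ⟨hvw, Perm.mem_cycleFactorsFinset_support_le hc hv⟩
  · intro h v
    by_contra! hv
    have hvT : v ∈ T := by_contra fun h => hv v h Perm.SameCycle.rfl
    refine h (σ.cycleOf v) (Perm.cycleOf_mem_cycleFactorsFinset_iff.2
      (Perm.mem_support.2 (hT v hvT))) fun w hw => ?_
    by_contra hwT
    exact hv w hwT (Perm.mem_support_cycleOf_iff.1 hw).1

open Classical in
/-- Without the condition `NoCycleIn σ T` the sum over the subsets of a cycle `c` is the product of
`1 + y v`; the condition removes the term of the full support of `c`. The points fixed by `σ` carry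
weight `0`, so only sets of moved points contribute. -/
theorem sum_noCycleIn_prod (σ : Perm V) (y : V → ℤ) (hy : ∀ v, σ v = v → y v = 0) :
    ∑ T with NoCycleIn σ T, ∏ v ∈ T, y v =
      ∏ c ∈ σ.cycleFactorsFinset, (∏ v ∈ c.support, (1 + y v) - ∏ v ∈ c.support, y v) := by
  rw [prod_sub]
  have hA : ∀ A ∈ σ.cycleFactorsFinset.powerset,
      (-1 : ℤ) ^ #A * (∏ c ∈ σ.cycleFactorsFinset \ A, ∏ v ∈ c.support, (1 + y v)) *
        ∏ c ∈ A, ∏ v ∈ c.support, y v =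
      ∑ T : Finset V, if ∀ c ∈ A, c.support ⊆ T then (-1 : ℤ) ^ #A * ∏ v ∈ T, y v else 0 := by
    intro A hA
    rw [mem_powerset] at hA
    have hcompl : ∏ c ∈ σ.cycleFactorsFinset \ A, ∏ v ∈ c.support, (1 + y v) =
        ∏ v ∈ (A.biUnion Perm.support)ᶜ, (1 + y v) := by
      rw [← prod_biUnion (pairwiseDisjoint_support σ sdiff_subset)]
      refine prod_subset (fun v hv => ?_) fun v hv hv' => ?_
      · obtain ⟨c, hc, hvc⟩ := mem_biUnion.1 hv
        rw [mem_sdiff] at hc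
        rw [mem_compl, mem_biUnion]
        rintro ⟨d, hd, hvd⟩
        have hdc : d = c := (Perm.cycle_is_cycleOf hvd (hA hd)).trans
          (Perm.cycle_is_cycleOf hvc hc.1).symm
        exact hc.2 (hdc ▸ hd)
      · rw [hy v, add_zero]
        by_contra hσv
        have hmem := Perm.cycleOf_mem_cycleFactorsFinset_iff.2 (Perm.mem_support.2 hσv)
        have hsupp : v ∈ (σ.cycleOf v).support :=
          Perm.mem_support_cycleOf_iff.2 ⟨Perm.SameCycle.rfl, Perm.mem_support.2 hσv⟩
        refine hv' (mem_biUnion.2 ⟨_, mem_sdiff.2 ⟨hmem, fun h => ?_⟩, hsupp⟩)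
        exact mem_compl.1 hv (mem_biUnion.2 ⟨_, h, hsupp⟩)
    rw [hcompl, ← prod_biUnion (pairwiseDisjoint_support σ hA), mul_assoc,
      mul_comm (∏ v ∈ (A.biUnion Perm.support)ᶜ, (1 + y v)), prod_mul_prod_compl_one_add,
      mul_sum, sum_filter]
    simp only [biUnion_subset]
  rw [sum_congr rfl hA, sum_comm, sum_filter]
  refine sum_congr rfl fun T _ => ?_
  -- Inclusion–exclusion over the sets of cycles contained in `T`.
  have hpow : {A ∈ σ.cycleFactorsFinset.powerset | ∀ c ∈ A, c.support ⊆ T} =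
      {c ∈ σ.cycleFactorsFinset | c.support ⊆ T}.powerset := by
    ext A
    simp only [mem_filter, mem_powerset, subset_iff, ← forall_and]
  rw [← sum_filter, hpow, ← sum_mul, sum_powerset_neg_one_pow_card, ite_mul, one_mul, zero_mul]
  by_cases hT : ∀ v ∈ T, σ v ≠ v
  · exact if_congr ((noCycleIn_iff hT).trans filter_eq_empty_iff.symm) rfl rfl
  · push Not at hT
    obtain ⟨v, hv, hσv⟩ := hT
    rw [prod_eq_zero hv (hy v hσv), ite_self, ite_self]

end Transfer

/-! ### Reversing some of the cycles -/

section Reversal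

variable {V : Type*} [Fintype V] [DecidableEq V]

/-- Every set of cycles of `σ` splits off as the set of cycles of a disjoint factor. -/
theorem exists_disjoint_mul_eq (σ : Perm V) (A : Finset (Perm V)) :
    A ⊆ σ.cycleFactorsFinset →
      ∃ p q : Perm V, p.Disjoint q ∧ p * q = σ ∧ p.cycleFactorsFinset = A := by
  induction A using Finset.induction_on with
  | empty => exact fun _ => ⟨1, σ, Perm.disjoint_one_left σ, one_mul σ, Perm.cycleFactorsFinset_one⟩
  | insert c A hcA ih =>
    intro hA
    obtain ⟨p, q, hpq, rfl, rfl⟩ := ih ((subset_insert _ _).trans hA)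
    have hc := hA (mem_insert_self _ _)
    rw [hpq.cycleFactorsFinset_mul_eq_union, mem_union] at hc
    have hcq := hc.resolve_left hcA
    have hpc : p.Disjoint c := hpq.mono le_rfl (Perm.mem_cycleFactorsFinset_support_le hcq)
    have hqc : (q * c⁻¹).Disjoint c := Perm.disjoint_mul_inv_of_mem_cycleFactorsFinset hcq
    have hpq' : p.Disjoint (q * c⁻¹) := hpq.mul_right hpc.inv_right
    refine ⟨p * c, q * c⁻¹, hpq'.mul_left hqc.symm, ?_, ?_⟩
    · rw [mul_assoc, ← hqc.commute.eq, inv_mul_cancel_right]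
    · rw [hpc.cycleFactorsFinset_mul_eq_union,
        ((Perm.mem_cycleFactorsFinset_iff.1 hcq).1).cycleFactorsFinset_eq_singleton, union_comm,
        insert_eq]

open Classical in
/-- A permutation with a choice of some of its cycles is the same as a pair of disjoint
permutations. -/
theorem sum_prod_cycleFactors_add {R : Type*} [CommRing R] (α β : Perm V → R) :
    ∑ σ : Perm V, ∏ c ∈ σ.cycleFactorsFinset, (α c + β c) =
      ∑ p : Perm V × Perm V with p.1.Disjoint p.2,
        (∏ c ∈ p.1.cycleFactorsFinset, α c) * ∏ c ∈ p.2.cycleFactorsFinset, β c := by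
  simp_rw [prod_add]
  rw [sum_sigma']
  symm
  refine sum_bij (fun p _ => ⟨p.1 * p.2, p.1.cycleFactorsFinset⟩) ?_ ?_ ?_ ?_
  · rintro ⟨p, q⟩ h
    simp only [mem_filter, mem_univ, true_and] at h
    rw [mem_sigma, mem_powerset, h.cycleFactorsFinset_mul_eq_union]
    exact ⟨mem_univ _, subset_union_left⟩
  · rintro ⟨p, q⟩ - ⟨p', q'⟩ - heq
    simp only [Sigma.mk.injEq, heq_eq_eq] at heq
    obtain ⟨h1, h2⟩ := heq
    obtain rfl := Perm.cycleFactorsFinset_injective h2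
    rw [mul_left_cancel h1]
  · rintro ⟨σ, A⟩ h
    simp only [mem_sigma, mem_univ, true_and, mem_powerset] at h
    obtain ⟨p, q, hpq, rfl, rfl⟩ := exists_disjoint_mul_eq σ A h
    exact ⟨(p, q), by simpa using hpq, rfl⟩
  · rintro ⟨p, q⟩ h
    simp only [mem_filter, mem_univ, true_and] at h
    simp only [h.cycleFactorsFinset_mul_eq_union,
      union_sdiff_cancel_left h.disjoint_cycleFactorsFinset]

theorem inv_mem_cycleFactorsFinset_inv {p c : Perm V} (hc : c ∈ p.cycleFactorsFinset) :
    c⁻¹ ∈ p⁻¹.cycleFactorsFinset := by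
  rw [Perm.mem_cycleFactorsFinset_iff] at hc ⊢
  refine ⟨hc.1.inv, fun a ha => ?_⟩
  have h := hc.2 (c⁻¹ a) (by rwa [← Perm.support_inv, Perm.apply_mem_support])
  rw [← Perm.mul_apply c, mul_inv_cancel, Perm.one_apply] at h
  exact (Perm.inv_eq_iff_eq.2 h).symm

theorem prod_cycleFactorsFinset_inv {R : Type*} [CommMonoid R] (α : Perm V → R) (p : Perm V) :
    ∏ c ∈ p⁻¹.cycleFactorsFinset, α c = ∏ c ∈ p.cycleFactorsFinset, α c⁻¹ := by
  refine prod_bij' (fun c _ => c⁻¹) (fun c _ => c⁻¹) (fun c hc => ?_)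
    (fun c hc => inv_mem_cycleFactorsFinset_inv hc) ?_ ?_ ?_
  · simpa using inv_mem_cycleFactorsFinset_inv hc
  all_goals simp

/-- Reversing the cycles weighted by `α` does not change the sum over all permutations. -/
theorem sum_prod_cycleFactors_inv_add {R : Type*} [CommRing R] (α β : Perm V → R) :
    ∑ σ : Perm V, ∏ c ∈ σ.cycleFactorsFinset, (α c⁻¹ + β c) =
      ∑ σ : Perm V, ∏ c ∈ σ.cycleFactorsFinset, (α c + β c) := by
  classical
  rw [sum_prod_cycleFactors_add (fun c => α c⁻¹), sum_prod_cycleFactors_add]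
  refine sum_bij' (fun p _ => (p.1⁻¹, p.2)) (fun p _ => (p.1⁻¹, p.2)) ?_ ?_ ?_ ?_ ?_
  · intro p hp
    simpa using (mem_filter.1 hp).2.inv_left
  · intro p hp
    simpa using (mem_filter.1 hp).2.inv_left
  · simp
  · simp
  · intro p _
    rw [prod_cycleFactorsFinset_inv]

theorem odd_orderOf_iff (σ : Perm V) :
    Odd (orderOf σ) ↔ ∀ c ∈ σ.cycleFactorsFinset, Odd #c.support := by
  constructor
  · intro h c hc
    refine h.of_dvd_nat (Perm.dvd_of_mem_cycleType ?_)
    rw [Perm.cycleType_def]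
    exact Multiset.mem_map_of_mem _ hc
  · intro h
    have hprod : Odd (∏ c ∈ σ.cycleFactorsFinset, #c.support) :=
      prod_induction _ Odd (fun _ _ => Odd.mul) odd_one h
    refine hprod.of_dvd_nat ?_
    rw [← Perm.lcm_cycleType, Multiset.lcm_dvd, Perm.cycleType_def]
    intro k hk
    obtain ⟨c, hc, rfl⟩ := Multiset.mem_map.1 hk
    exact dvd_prod_of_mem _ hc

end Reversal

/-! ### Cycle weights of a tournament -/

section Tournament

variable {V : Type*} [Fintype V] [DecidableEq V]

open Classical in
/-- The entry at `(u, v)` of the adjacency matrix of `D`. -/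
noncomputable def adjIndicator (D : Digraph V) (u v : V) : ℤ := if D.Adj u v then 1 else 0

/-- The product of the adjacency matrix entries of `D` along the arcs `v → c v` with `c v ≠ v`. For
a cycle `c` it indicates whether `c` is a directed cycle of `D`. -/
noncomputable def cycleWeight (D : Digraph V) (c : Perm V) : ℤ :=
  ∏ v ∈ c.support, adjIndicator D v (c v)

open Classical in
theorem cycleWeight_of_mem {D : Digraph V} {σ c : Perm V} (hc : c ∈ σ.cycleFactorsFinset) :
    cycleWeight D c = if IsDirectedCycleOf D c then 1 else 0 := by
  have hcyc := (Perm.mem_cycleFactorsFinset_iff.1 hc).1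
  unfold cycleWeight adjIndicator
  rw [prod_boole]
  have hiff : (∀ v ∈ c.support, D.Adj v (c v)) ↔ IsDirectedCycleOf D c := by
    simp [IsDirectedCycleOf, hcyc]
  by_cases h : IsDirectedCycleOf D c
  · rw [if_pos h, if_pos (hiff.2 h)]
  · rw [if_neg h, if_neg (mt hiff.1 h)]

/-- In a tournament, a cycle all of whose arcs avoid the complement is the reverse of a directed
cycle of the complement. -/
theorem prod_one_sub_adjIndicator {D : Digraph V} (hD : IsTournament D) (c : Perm V) :
    ∏ v ∈ c.support, (1 - adjIndicator (complement D) v (c v)) =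
      cycleWeight (complement D) c⁻¹ := by
  unfold cycleWeight
  refine prod_bij (fun v _ => c v) (fun v hv => ?_) (fun _ _ _ _ h => c.injective h)
    (fun v hv => ⟨c⁻¹ v, ?_, by simp⟩) fun v hv => ?_
  · rwa [Perm.support_inv, Perm.apply_mem_support]
  · rwa [← Perm.support_inv, Perm.apply_mem_support]
  · have h1 := complement_adj_iff_of_isTournament hD v (c v)
    have h2 := complement_adj_iff_of_isTournament hD (c v) v
    have h3 := hD.2 v (c v) (Perm.mem_support.1 hv).symm
    have h4 : c⁻¹ (c v) = v := c.symm_apply_apply v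
    change 1 - adjIndicator _ v (c v) = adjIndicator _ (c v) (c⁻¹ (c v))
    rw [h4, adjIndicator, adjIndicator]
    rcases h3 with h | h
    · rw [if_neg (mt h1.1 h.2), if_pos (h2.2 h.1), sub_zero]
    · rw [if_pos (h1.2 h.1), if_neg (mt h2.1 h.2), sub_self]

/-- A directed cycle of odd length contributes a factor `2`, one of even length a factor `0`. -/
theorem prod_cycleWeight_sub {D : Digraph V} (σ : Perm V) :
    ∏ c ∈ σ.cycleFactorsFinset, (cycleWeight D c + -((-1) ^ #c.support * cycleWeight D c)) =
      if σ ∈ oddCyclePerms D then 2 ^ nsc σ else 0 := by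
  classical
  split_ifs with h
  · simp only [oddCyclePerms, mem_filter, mem_univ, true_and, odd_orderOf_iff] at h
    unfold nsc
    rw [← prod_const]
    refine prod_congr rfl fun c hc => ?_
    rw [cycleWeight_of_mem hc, if_pos (h.2 c hc), (h.1 c hc).neg_one_pow]
    norm_num
  · simp only [oddCyclePerms, mem_filter, mem_univ, true_and, odd_orderOf_iff, not_and_or,
      not_forall] at h
    rcases h with ⟨c, hc, h⟩ | ⟨c, hc, h⟩
    · exact prod_eq_zero hc (by rw [(Nat.not_odd_iff_even.1 h).neg_one_pow]; ring)
    · exact prod_eq_zero hc (by rw [cycleWeight_of_mem hc, if_neg h]; ring)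

open Classical in
/-- The sum on the left counts the Hamiltonian paths of `D`, written as full cycles through the
extra point `none`: since a tournament and its complement partition the arcs, `1` minus the
indicator of the complement is the indicator of `D`, and arcs at `none` are unconstrained. -/
theorem sum_isFullCycle_eq_sum_oddCyclePerms {D : Digraph V} (hD : IsTournament D) :
    ∑ τ : Perm (Option V) with IsFullCycle τ,
        ∏ v, (1 + (τ (some v)).elim 0 fun w => -adjIndicator (complement D) v w) =
      ∑ w ∈ oddCyclePerms (complement D), 2 ^ nsc w := by
  calc
    _ = ∑ T : Finset V, ∑ τ : Perm (Option V) with IsFullCycle τ,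
          ∏ v ∈ T, (τ (some v)).elim 0 fun w => -adjIndicator (complement D) v w := by
      rw [sum_comm]
      simp_rw [prod_one_add, powerset_univ]
    _ = ∑ T : Finset V, ∑ σ : Perm V with NoCycleIn σ T,
          ∏ v ∈ T, -adjIndicator (complement D) v (σ v) :=
      sum_congr rfl fun T _ =>
        sum_isFullCycle_prod (fun v w => -adjIndicator (complement D) v w) T
    _ = ∑ σ : Perm V, ∑ T with NoCycleIn σ T,
          ∏ v ∈ T, -adjIndicator (complement D) v (σ v) := by
      simp_rw [sum_filter]
      exact sum_comm
    _ = ∑ σ : Perm V, ∏ c ∈ σ.cycleFactorsFinset, (cycleWeight (complement D) c⁻¹ +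
          -((-1) ^ #c.support * cycleWeight (complement D) c)) := by
      refine sum_congr rfl fun σ _ => ?_
      rw [sum_noCycleIn_prod σ (fun v => -adjIndicator (complement D) v (σ v))
        fun v hv => by simp [adjIndicator, complement, hv]]
      refine prod_congr rfl fun c hc => ?_
      have hσc := (Perm.mem_cycleFactorsFinset_iff.1 hc).2
      rw [← prod_one_sub_adjIndicator hD, cycleWeight, ← prod_neg, sub_eq_add_neg]
      congr 1
      · exact prod_congr rfl fun v hv => by rw [hσc v hv, sub_eq_add_neg]
      · exact congrArg _ (prod_congr rfl fun v hv => by rw [hσc v hv])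
    _ = ∑ σ : Perm V, ∏ c ∈ σ.cycleFactorsFinset, (cycleWeight (complement D) c +
          -((-1) ^ #c.support * cycleWeight (complement D) c)) :=
      sum_prod_cycleFactors_inv_add _ _
    _ = _ := by
      simp_rw [prod_cycleWeight_sub]
      rw [← sum_filter, filter_univ_mem]

end Tournament

/-! ### Permutations of `[n]` as full cycles through an extra point -/

section Listings

/-- The position in the cyclic order `none, 1, 2, …, n`, starting from `0`. -/
def position {n : ℕ} (o : Option (Bracket n)) : Fin (n + 1) :=
  o.elim 0 fun i => ⟨i, Nat.lt_succ_of_le (mem_Icc.1 i.2).2⟩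

theorem position_bijective (n : ℕ) : Function.Bijective (position (n := n)) := by
  rw [Fintype.bijective_iff_injective_and_card]
  constructor
  · intro a b h
    rw [Fin.ext_iff] at h
    rcases a with _ | ⟨a, ha⟩ <;> rcases b with _ | ⟨b, hb⟩ <;>
      simp only [position, Option.elim, Fin.val_zero] at h
    · rfl
    · have := mem_Icc.1 hb
      omega
    · have := mem_Icc.1 ha
      omega
    · subst h
      rfl
  · simp

/-- The cycle `none → 1 → 2 → ⋯ → n → none`. -/
noncomputable def succCycle (n : ℕ) : Perm (Option (Bracket n)) :=
  (Equiv.ofBijective _ (position_bijective n)).symm.permCongr (finRotate (n + 1))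

theorem position_succCycle {n : ℕ} (o : Option (Bracket n)) :
    position (succCycle n o) = position o + 1 := by
  have h := (Equiv.ofBijective _ (position_bijective n)).apply_symm_apply
    (finRotate (n + 1) (position o))
  exact h.trans (finRotate_apply _)

theorem exists_succCycle_pow {n : ℕ} (o : Option (Bracket n)) :
    ∃ k : ℕ, (succCycle n ^ k) none = o := by
  have key : ∀ k : ℕ, position ((succCycle n ^ k) none) = Fin.ofNat (n + 1) k := by
    intro k
    induction k with
    | zero => rfl
    | succ k ih =>
      rw [pow_succ', Perm.mul_apply, position_succCycle, ih]
      simp [Fin.ext_iff, Fin.val_add]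
  refine ⟨position o, (position_bijective n).1 ?_⟩
  rw [key, Fin.ofNat_val_eq_self]

theorem isFullCycle_succCycle (n : ℕ) : IsFullCycle (succCycle n) := by
  have h : ∀ o, (succCycle n).SameCycle none o := fun o => by
    obtain ⟨k, hk⟩ := exists_succCycle_pow o
    exact ⟨k, by rwa [zpow_natCast]⟩
  exact fun a b => (h a).symm.trans (h b)

theorem succCycle_some_eq_some {n : ℕ} (i j : Bracket n) :
    succCycle n (some i) = some j ↔ (j : ℕ) = i + 1 := by
  rw [← (position_bijective n).1.eq_iff, position_succCycle, Fin.ext_iff, Fin.val_add_one]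
  have hi := mem_Icc.1 i.2
  have hj := mem_Icc.1 j.2
  simp only [position, Option.elim, Fin.ext_iff, Fin.val_last]
  split_ifs <;> omega

/-- The cycle `none → π 1 → π 2 → ⋯ → π n → none`. -/
noncomputable def listingCycle {n : ℕ} (π : Perm (Bracket n)) : Perm (Option (Bracket n)) :=
  optionCongr π * succCycle n * (optionCongr π)⁻¹

theorem isFullCycle_listingCycle {n : ℕ} (π : Perm (Bracket n)) :
    IsFullCycle (listingCycle π) :=
  fun _ _ => Perm.sameCycle_conj.2 (isFullCycle_succCycle n _ _)

theorem listingCycle_injective (n : ℕ) : Function.Injective (listingCycle (n := n)) := by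
  intro π ρ h
  have hpow : ∀ (π : Perm (Bracket n)) (k : ℕ),
      (listingCycle π ^ k) none = optionCongr π ((succCycle n ^ k) none) := by
    intro π k
    rw [listingCycle, conj_pow]
    rfl
  refine optionCongr_injective (Equiv.ext fun o => ?_)
  obtain ⟨k, rfl⟩ := exists_succCycle_pow o
  rw [← hpow, ← hpow, h]

theorem listingCycle_some_eq_some {n : ℕ} (π : Perm (Bracket n)) (i j : Bracket n) :
    listingCycle π (some (π i)) = some (π j) ↔ (j : ℕ) = i + 1 := by
  rw [← succCycle_some_eq_some]
  have h1 : (optionCongr π)⁻¹ (some (π i)) = some i := Perm.inv_eq_iff_eq.2 rfl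
  have h2 : some (π j) = optionCongr π (some j) := rfl
  rw [listingCycle, Perm.mul_apply, Perm.mul_apply, h1, h2, (optionCongr π).apply_eq_iff_eq]

open Classical in
/-- `listingCycle` is a bijection onto the full cycles: it is injective, and both sides have `n!`
elements. -/
theorem sum_listingCycle {n : ℕ} {M : Type*} [AddCommMonoid M]
    (f : Perm (Option (Bracket n)) → M) :
    ∑ π : Perm (Bracket n), f (listingCycle π) =
      ∑ τ : Perm (Option (Bracket n)) with IsFullCycle τ, f τ := by
  have hcard : #{τ : Perm (Option (Bracket n)) | IsFullCycle τ} = n.factorial := by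
    rw [← card_isFullCycle_eqOn n ∅ (succCycle n) (by simp)
      (fun v => ⟨v, notMem_empty v, Perm.SameCycle.rfl⟩)]
    simp
  have himage : univ.image (listingCycle (n := n)) =
      ({τ : Perm (Option (Bracket n)) | IsFullCycle τ} : Finset _) := by
    refine eq_of_subset_of_card_le (fun τ hτ => ?_) ?_
    · obtain ⟨π, -, rfl⟩ := mem_image.1 hτ
      exact mem_filter.2 ⟨mem_univ _, isFullCycle_listingCycle π⟩
    · rw [hcard, card_image_of_injective _ (listingCycle_injective n), card_univ,
        Fintype.card_perm, Fintype.card_coe, Nat.card_Icc, Nat.add_sub_cancel]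
  rw [← himage, sum_image fun _ _ _ _ h => listingCycle_injective n h]

theorem XDes_eq_empty_iff {X : Set (ℕ × ℕ)} {n : ℕ} (π : Perm (Bracket n)) :
    XDes X π = ∅ ↔ ∀ i j : Bracket n, (j : ℕ) = i + 1 →
      ¬ (complement (descentGraph X n)).Adj (π i) (π j) := by
  rw [Set.eq_empty_iff_forall_notMem]
  constructor
  · rintro h ⟨i, hi⟩ ⟨j, hj⟩ hij ⟨hne, hadj⟩
    simp only at hij
    subst hij
    exact h i ⟨hi, hj, by_contra fun hX => hadj ⟨hX, hne⟩⟩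
  · rintro h i ⟨hi, hj, hX⟩
    refine h ⟨i, hi⟩ ⟨i + 1, hj⟩ rfl ⟨fun heq => ?_, fun hadj => hadj.1 hX⟩
    have := congrArg Subtype.val (π.injective heq)
    simp at this

open Classical in
theorem prod_listingCycle {X : Set (ℕ × ℕ)} {n : ℕ} (π : Perm (Bracket n)) :
    ∏ v, (1 + (listingCycle π (some v)).elim 0
        fun w => -adjIndicator (complement (descentGraph X n)) v w) =
      if XDes X π = ∅ then 1 else 0 := by
  have hterm : ∀ v, (1 + (listingCycle π (some v)).elim 0
        fun w => -adjIndicator (complement (descentGraph X n)) v w) =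
      if ∀ w, listingCycle π (some v) = some w →
        ¬ (complement (descentGraph X n)).Adj v w then 1 else 0 := by
    intro v
    cases listingCycle π (some v) with
    | none => simp
    | some w => by_cases h : (complement (descentGraph X n)).Adj v w <;> simp [adjIndicator, h]
  have hiff : (∀ v ∈ univ, ∀ w, listingCycle π (some v) = some w →
      ¬ (complement (descentGraph X n)).Adj v w) ↔ XDes X π = ∅ := by
    rw [XDes_eq_empty_iff]
    simp only [mem_univ, true_imp_iff]
    rw [← π.forall_congr_right]
    refine forall_congr' fun i => ?_
    rw [← π.forall_congr_right]
    simp only [listingCycle_some_eq_some]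
  simp_rw [hterm]
  rw [prod_boole]
  by_cases h : XDes X π = ∅
  · rw [if_pos h, if_pos (hiff.2 h)]
  · rw [if_neg h, if_neg (mt hiff.1 h)]

theorem descentCount_empty_eq_sum (X : Set (ℕ × ℕ)) (n : ℕ) :
    (descentCount X ∅ n : ℤ) = ∑ π : Perm (Bracket n),
      ∏ v, (1 + (listingCycle π (some v)).elim 0
        fun w => -adjIndicator (complement (descentGraph X n)) v w) := by
  classical
  simp_rw [prod_listingCycle]
  rw [sum_boole, descentCount, descentClass, Set.ncard_eq_toFinset_card']
  simp

end Listings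

end XDescent

theorem theorem3p3 (X : Set (ℕ × ℕ))
    (hX : ∀ n : ℕ, XDescent.IsTournament (XDescent.descentGraph X n)) (n : ℕ) :
    XDescent.descentCount X ∅ n =
      ∑ w ∈ XDescent.oddCyclePerms (XDescent.complement (XDescent.descentGraph X n)),
        2 ^ XDescent.nsc w := by
  rw [← Nat.cast_inj (R := ℤ), XDescent.descentCount_empty_eq_sum,
    XDescent.sum_listingCycle fun τ =>
      ∏ v, (1 + (τ (some v)).elim 0
        fun w => -XDescent.adjIndicator (XDescent.complement (XDescent.descentGraph X n)) v w),
    XDescent.sum_isFullCycle_eq_sum_oddCyclePerms (hX n)]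
  push_cast
  rfl
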